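/- For $f:\mathbb R^n\to[0,\infty)$, $\theta\in[0,1]$ and $t\ge 0$ put $S_{\ge t}(f)=\{x: f(x)\ge t\}$, $S_{>t}(f)=\{x: f(x)>t\}$, $$\Delta_{-\infty,\theta}f(z)=\sup_{z=(1-\theta)x-\theta y}\min\{f(x),f(y)\},\qquad \widetilde\Delta_{-\infty}f(z)=\sup_{\substack{z=(1-\theta)x-\theta y\\ \theta\in[0,1]}}\min\{f(x),f(y)\}$$ (with values in $[0,\infty]$). A function $\phi:\mathbb R^n\to[0,\infty)$ is radially decreasing if $\phi(tx)\ge\phi(x)$ for all $t\in[0,1]$ and $x\in\mathbb R^n$. Theorem. Let $f:\mathbb R^n\to[0,\infty)$ be an integrable quasi-concave function, and let $\mu$ be a measure on $\mathbb R^n$ with $\mathrm d\mu(x)=\phi(x)\,\mathrm dx$, where $\phi:\mathbb R^n\to[0,\infty)$ is measurable and radially decreasing. Then $$\int_0^1\int_{\mathbb R^n}\Delta_{-\infty,\theta}f(x)\,\mathrm d\mu(x)\,\mathrm d\theta\le\frac{2^n}{n+1}\int_0^\infty\sup_{\substack{y\in S_{\ge t}(f)\\ \theta\in(0,1]}}\frac{\mu\bigl((1-\theta)y-\theta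 S_{\ge t}(f)\bigr)}{\theta^n}\,\mathrm dt .$$ If, moreover, the closure of every non-empty superlevel set $S_{>t}(f)$ contains the origin (for instance, if $f$ attains its maximum at the origin), then $$\int_{\mathbb R^n}\widetilde\Delta_{-\infty}f(x)\,\mathrm d\mu(x)\le 2^n\int_0^\infty\sup_{\substack{y\in S_{\ge t}(f)\\ \theta\in(0,1]}}\frac{\mu\bigl((1-\theta)y-\theta S_{\ge t}(f)\bigr)}{\theta^n}\,\mathrm dt .$$ In particular, for the Lebesgue measure, $$\int_0^1\int_{\mathbb R^n}\Delta_{-\infty,\theta}f(x)\,\mathrm dx\,\mathrm d\theta\le\frac{2^n}{n+1}\int_{\mathbb R^n}f(x)\,\mathrm dx ,$$ and, if the closure of every non-empty superlevel set $S_{>t}(f)$ contains the origin, $$\int_{\mathbb R^n}\widetilde\Delta_{-\infty}f(x)\,\mathrm dx\le 2^n\int_{\mathbb R^n}f(x)\,\mathrm dx .$$ -/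

import Mathlib

open MeasureTheory Set
open scoped ENNReal

noncomputable section

/-- A function on `ℝⁿ` is radially decreasing if `φ (t x) ≥ φ x` for all `t ∈ [0,1]` and all `x`. -/
def RadiallyDecreasing {n : ℕ} (φ : EuclideanSpace ℝ (Fin n) → ℝ) : Prop :=
  ∀ t ∈ Icc (0 : ℝ) 1, ∀ x, φ x ≤ φ (t • x)

/-- The measure `dμ = φ dx` on `ℝⁿ`. -/
def densityMeasure {n : ℕ} (φ : EuclideanSpace ℝ (Fin n) → ℝ) :
    Measure (EuclideanSpace ℝ (Fin n)) :=
  (volume : Measure (EuclideanSpace ℝ (Fin n))).withDensity (fun x => ENNReal.ofReal (φ x))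

/-- The superlevel set `S_{≥ t}(f)`. -/
def superlevelGE {n : ℕ} (f : EuclideanSpace ℝ (Fin n) → ℝ) (t : ℝ) :
    Set (EuclideanSpace ℝ (Fin n)) :=
  {x | t ≤ f x}

/-- The strict superlevel set `S_{> t}(f)`. -/
def superlevelGT {n : ℕ} (f : EuclideanSpace ℝ (Fin n) → ℝ) (t : ℝ) :
    Set (EuclideanSpace ℝ (Fin n)) :=
  {x | t < f x}

/-- `Δ_{-∞,θ} f (z) = sup_{z = (1-θ)x - θy} min {f x, f y}`, with values in `[0,∞]`
(the supremum is infinite at some points when `f` is unbounded). -/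
def thetaDifference {n : ℕ} (θ : ℝ) (f : EuclideanSpace ℝ (Fin n) → ℝ)
    (z : EuclideanSpace ℝ (Fin n)) : ℝ≥0∞ :=
  ⨆ (x : EuclideanSpace ℝ (Fin n)) (y : EuclideanSpace ℝ (Fin n))
    (_ : z = (1 - θ) • x - θ • y), ENNReal.ofReal (min (f x) (f y))

/-- `Δ̃_{-∞} f (z)`: the supremum of `min {f x, f y}` over all `θ ∈ [0,1]` and all `x, y` with
`z = (1-θ)x - θy`. -/
def hullDifference {n : ℕ} (f : EuclideanSpace ℝ (Fin n) → ℝ)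
    (z : EuclideanSpace ℝ (Fin n)) : ℝ≥0∞ :=
  ⨆ (θ : ℝ) (_ : θ ∈ Icc (0 : ℝ) 1)
    (x : EuclideanSpace ℝ (Fin n)) (y : EuclideanSpace ℝ (Fin n))
    (_ : z = (1 - θ) • x - θ • y), ENNReal.ofReal (min (f x) (f y))

/-- The supremum over `y ∈ K` and `θ ∈ (0,1]` of `μ ((1-θ)y - θK) / θⁿ`. -/
def supTranslate {n : ℕ} (μ : Measure (EuclideanSpace ℝ (Fin n)))
    (K : Set (EuclideanSpace ℝ (Fin n))) : ℝ≥0∞ :=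
  ⨆ (y : EuclideanSpace ℝ (Fin n)) (_ : y ∈ K) (θ : ℝ) (_ : θ ∈ Ioc (0 : ℝ) 1),
    μ ((fun x => (1 - θ) • y - θ • x) '' K) / ENNReal.ofReal (θ ^ n)

end

open scoped Pointwise

/-! By the layer-cake formula everything reduces to a Rogers–Shephard inequality for a convex set
`K` of finite volume. The level sets of the two difference functions are `C = jointDifference K` in
`ℝⁿ × [0,1]` and its projection to `ℝⁿ`, with `K` a strict superlevel set of `f`.

To bound `(μ ⊗ dθ)(C)`, integrate the volume of `(1-θ)K ∩ (z + θK)` over `z` and `θ` in two ways.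
Fubini bounds it above by `B · vol K · S`, where `B = ∫ θⁿ(1-θ)ⁿ dθ` over `(0,1)` and `S =
supTranslate μ K` (`lintegral_differenceFiber_le`). For the lower bound, contract `C` towards `(0,
1/2)` with ratio `1-s`: over a contracted point the intersection contains a translate of `(s/2)K`
(`exists_vadd_smul_subset_differenceFiber`), so its volume is at least `(s/2)ⁿ vol K`. Averaging
over `s` with density `n sⁿ⁻¹`, and using that a radially decreasing density loses at most the
factor `(1-s)ⁿ⁺¹` under the contraction, gives at least `2⁻ⁿ (n+1) B · vol K · (μ ⊗ dθ)(C)`.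
Cancelling `B · vol K` yields the constant `2ⁿ/(n+1)` (`measure_jointDifference_le`).

If `0 ∈ closure K`, the closure of `C` contains the segment `{0} × [0,1]`. Over a point of the
projection contracted by `1-s` it therefore contains an interval of length `s`, and the same
averaging costs only a factor `n+1` (`measure_fst_image_jointDifference_le`).

Convex sets are null-measurable but need not be Borel, hence the Fubini statements for
null-measurable sets. -/

/-! ### Fubini and layer cake for null-measurable sets -/

theorem measure_prod_apply₀ {α β : Type*} [MeasurableSpace α] [MeasurableSpace β]
    {μ : Measure α} {ν : Measure β} [SFinite ν] {s : Set (α × β)}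
    (hs : NullMeasurableSet s (μ.prod ν)) :
    μ.prod ν s = ∫⁻ x, ν {y | (x, y) ∈ s} ∂μ := by
  obtain ⟨t, ht, hst⟩ := hs
  rw [measure_congr hst, Measure.prod_apply ht]
  refine lintegral_congr_ae ?_
  filter_upwards [Measure.ae_ae_of_ae_prod hst] with x hx
  exact (measure_congr hx).symm

theorem measure_prod_apply_symm₀ {α β : Type*} [MeasurableSpace α] [MeasurableSpace β]
    {μ : Measure α} {ν : Measure β} [SFinite μ] [SFinite ν] {s : Set (α × β)}
    (hs : NullMeasurableSet s (μ.prod ν)) :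
    μ.prod ν s = ∫⁻ y, μ {x | (x, y) ∈ s} ∂ν := by
  have hs' : NullMeasurableSet (Prod.swap ⁻¹' s) (ν.prod μ) :=
    hs.preimage Measure.measurePreserving_swap.quasiMeasurePreserving
  have h := measure_prod_apply₀ hs'
  rwa [Measure.measurePreserving_swap.measure_preimage hs] at h

theorem aemeasurable_of_nullMeasurableSet_lt {α : Type*} [MeasurableSpace α] {μ : Measure α}
    {F : α → ℝ≥0∞} (hF : ∀ t, NullMeasurableSet {x | t < F x} μ) : AEMeasurable F μ := by
  have h : NullMeasurable F μ :=
    @measurable_of_Ioi ℝ≥0∞ (NullMeasurableSpace α μ) _ _ _ _ _ _ _ F hF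
  exact h.aemeasurable

theorem volume_restrict_ofReal_lt (a : ℝ≥0∞) :
    volume.restrict (Ioi (0 : ℝ)) {t | ENNReal.ofReal t < a} = a := by
  rcases eq_or_ne a ∞ with rfl | ha
  · simp
  · have hm : MeasurableSet {t : ℝ | ENNReal.ofReal t < a} :=
      measurableSet_lt ENNReal.measurable_ofReal measurable_const
    rw [Measure.restrict_apply hm]
    have : {t : ℝ | ENNReal.ofReal t < a} ∩ Ioi 0 = Ioo 0 a.toReal := by
      ext t
      simp only [mem_inter_iff, mem_ofPred_eq, mem_Ioi, mem_Ioo]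
      constructor
      · rintro ⟨h1, h2⟩
        exact ⟨h2, (ENNReal.ofReal_lt_iff_lt_toReal h2.le ha).1 h1⟩
      · rintro ⟨h1, h2⟩
        exact ⟨(ENNReal.ofReal_lt_iff_lt_toReal h1.le ha).2 h2, h1⟩
    rw [this, Real.volume_Ioo, sub_zero, ENNReal.ofReal_toReal ha]

/-- Apply Fubini to the region under the graph. Infinite values of `F` are harmless, since the real
heights below `∞` have infinite length. -/
theorem lintegral_eq_lintegral_measure_ofReal_lt {α : Type*} [MeasurableSpace α] {μ : Measure α}
    [SFinite μ] {F : α → ℝ≥0∞} (hF : AEMeasurable F μ) :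
    ∫⁻ x, F x ∂μ = ∫⁻ t in Ioi (0 : ℝ), μ {x | ENNReal.ofReal t < F x} := by
  obtain ⟨G, hG, hFG⟩ := hF
  have hm : MeasurableSet {p : α × ℝ | ENNReal.ofReal p.2 < G p.1} :=
    measurableSet_lt (ENNReal.measurable_ofReal.comp measurable_snd) (hG.comp measurable_fst)
  have h1 := Measure.prod_apply (μ := μ) (ν := volume.restrict (Ioi (0 : ℝ))) hm
  rw [Measure.prod_apply_symm hm] at h1
  rw [lintegral_congr_ae hFG]
  calc ∫⁻ x, G x ∂μ = ∫⁻ x, volume.restrict (Ioi (0 : ℝ)) {t | ENNReal.ofReal t < G x} ∂μ := by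
        simp_rw [volume_restrict_ofReal_lt]
    _ = ∫⁻ t in Ioi (0 : ℝ), μ {x | ENNReal.ofReal t < G x} := h1.symm
    _ = _ := by
        refine lintegral_congr fun t => measure_congr ?_
        filter_upwards [hFG] with x hx
        exact congrArg (fun a => ENNReal.ofReal t < a) hx.symm

/-! ### Homotheties and densities that increase under contraction -/

section Homothety

variable {E : Type*} [NormedAddCommGroup E] [NormedSpace ℝ E] [MeasurableSpace E] [BorelSpace E]

theorem measurableEmbedding_homothety (p : E) {r : ℝ} (hr : r ≠ 0) :
    MeasurableEmbedding (AffineMap.homothety p r : E → E) := by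
  have h : (AffineMap.homothety p r : E → E) =
      (fun x => x + p) ∘ (fun x => r • x) ∘ (fun x => x + -p) := by
    ext x
    simp [AffineMap.homothety_apply, sub_eq_add_neg]
  rw [h]
  exact (measurableEmbedding_addRight p).comp
    ((measurableEmbedding_const_smul₀ hr).comp (measurableEmbedding_addRight (-p)))

variable [FiniteDimensional ℝ E]

theorem smul_map_homothety (l : Measure E) [l.IsAddHaarMeasure] (p : E) {r : ℝ} (hr : 0 < r) :
    ENNReal.ofReal (r ^ Module.finrank ℝ E) • l.map (AffineMap.homothety p r) = l := by
  ext s _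
  have hsurj : Function.Surjective (AffineMap.homothety p r : E → E) := fun y => by
    refine ⟨AffineMap.homothety p r⁻¹ y, ?_⟩
    simp [AffineMap.homothety_apply, smul_smul, hr.ne']
  rw [Measure.smul_apply, (measurableEmbedding_homothety p hr.ne').map_apply, smul_eq_mul]
  have h := Measure.addHaar_image_homothety l p r (AffineMap.homothety p r ⁻¹' s)
  rw [image_preimage_eq _ hsurj, abs_of_pos (pow_pos hr _)] at h
  exact h.symm

/-- If a density does not decrease under a contraction, the measure of the contracted set is at
least the one predicted by scaling. -/
theorem pow_finrank_mul_withDensity_le_image_homothety (l : Measure E) [l.IsAddHaarMeasure]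
    {ψ : E → ℝ≥0∞} (p : E) {r : ℝ} (hr : 0 < r)
    (hψ : ∀ x, ψ x ≤ ψ (AffineMap.homothety p r x)) (A : Set E) :
    ENNReal.ofReal (r ^ Module.finrank ℝ E) * l.withDensity ψ A
      ≤ l.withDensity ψ (AffineMap.homothety p r '' A) := by
  have he := measurableEmbedding_homothety p hr.ne'
  rw [withDensity_apply', withDensity_apply']
  conv_rhs => rw [← smul_map_homothety l p hr]
  rw [Measure.restrict_smul, lintegral_smul_measure, he.restrict_map, he.lintegral_map,
    preimage_image_eq _ he.injective, smul_eq_mul]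
  exact mul_le_mul_right (lintegral_mono hψ) _

end Homothety

theorem aemeasurable_measure_prodMk₀ {α β : Type*} [MeasurableSpace α] [MeasurableSpace β]
    {μ : Measure α} {ν : Measure β} [SFinite ν] {s : Set (α × β)}
    (hs : NullMeasurableSet s (μ.prod ν)) :
    AEMeasurable (fun x => ν {y | (x, y) ∈ s}) μ := by
  obtain ⟨t, ht, hst⟩ := hs
  refine ⟨fun x => ν (Prod.mk x ⁻¹' t), measurable_measure_prodMk_left ht, ?_⟩
  filter_upwards [Measure.ae_ae_of_ae_prod hst] with x hx
  exact measure_congr hx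

/-! ### Convex geometry of the joint difference set -/

section Sets

variable {V : Type*} [AddCommGroup V] [Module ℝ V]

/-- The set of pairs `(z, θ)` with `θ ∈ [0,1]` and `z ∈ (1-θ)K - θK`. -/
def jointDifference (K : Set V) : Set (V × ℝ) :=
  {p | p.2 ∈ Icc (0 : ℝ) 1 ∧ ∃ x ∈ K, ∃ y ∈ K, p.1 = (1 - p.2) • x - p.2 • y}

/-- The intersection of `(1-θ)K` and `z + θK`. -/
def differenceFiber (K : Set V) (θ : ℝ) (z : V) : Set V :=
  {w | w ∈ (1 - θ) • K ∧ w - z ∈ θ • K}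

/-- The pairs `(x, s)` with `s ∈ (0,1)` such that `x` lies in the image of `C` under the homothety
with centre `p` and ratio `1 - s`. -/
def contractionCone (C : Set V) (p : V) : Set (V × ℝ) :=
  {q | q.2 ∈ Ioo (0 : ℝ) 1 ∧ ∃ c ∈ C, q.1 = (1 - q.2) • c + q.2 • p}

/-- The coefficients `a(1-θ₁)` and `b(1-θ₂)` add up to `1-θ` for the combined `θ`, and `aθ₁`, `bθ₂`
add up to `θ`, so convexity of `K` merges the two `x`'s and the two `y`'s separately. -/
theorem convex_jointDifference {K : Set V} (hK : Convex ℝ K) : Convex ℝ (jointDifference K) := by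
  rintro ⟨z₁, θ₁⟩ ⟨h₁, x₁, hx₁, y₁, hy₁, e₁⟩ ⟨z₂, θ₂⟩ ⟨h₂, x₂, hx₂, y₂, hy₂, e₂⟩ a b ha hb hab
  dsimp only at h₁ h₂ e₁ e₂
  refine ⟨convex_Icc 0 1 h₁ h₂ ha hb hab, ?_⟩
  obtain ⟨x, hx, ex⟩ := hK.exists_mem_add_smul_eq hx₁ hx₂
    (mul_nonneg ha (sub_nonneg.2 h₁.2)) (mul_nonneg hb (sub_nonneg.2 h₂.2))
  obtain ⟨y, hy, ey⟩ := hK.exists_mem_add_smul_eq hy₁ hy₂ (mul_nonneg ha h₁.1) (mul_nonneg hb h₂.1)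
  refine ⟨x, hx, y, hy, ?_⟩
  have hθ : 1 - (a * θ₁ + b * θ₂) = a * (1 - θ₁) + b * (1 - θ₂) := by linear_combination -hab
  simp only [Prod.fst_add, Prod.smul_fst, Prod.snd_add, Prod.smul_snd, smul_eq_mul]
  rw [hθ, ex, ey, e₁, e₂]
  module

theorem convex_contractionCone {C : Set V} (hC : Convex ℝ C) (p : V) :
    Convex ℝ (contractionCone C p) := by
  rintro ⟨x₁, s₁⟩ ⟨h₁, c₁, hc₁, e₁⟩ ⟨x₂, s₂⟩ ⟨h₂, c₂, hc₂, e₂⟩ a b ha hb hab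
  dsimp only at h₁ h₂ e₁ e₂
  refine ⟨convex_Ioo 0 1 h₁ h₂ ha hb hab, ?_⟩
  obtain ⟨x, hx, ex⟩ := hC.exists_mem_add_smul_eq hc₁ hc₂
    (mul_nonneg ha (sub_nonneg.2 h₁.2.le)) (mul_nonneg hb (sub_nonneg.2 h₂.2.le))
  refine ⟨x, hx, ?_⟩
  have hθ : 1 - (a * s₁ + b * s₂) = a * (1 - s₁) + b * (1 - s₂) := by linear_combination -hab
  simp only [Prod.fst_add, Prod.smul_fst, Prod.snd_add, Prod.smul_snd, smul_eq_mul]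
  rw [hθ, ex, e₁, e₂]
  module

theorem convex_setOf_mem_differenceFiber {K : Set V} (hK : Convex ℝ K) (θ : ℝ) :
    Convex ℝ {q : V × V | q.1 ∈ differenceFiber K θ q.2} :=
  ((hK.smul (1 - θ)).linear_preimage (LinearMap.fst ℝ V V)).inter
    ((hK.smul θ).linear_preimage (LinearMap.fst ℝ V V - LinearMap.snd ℝ V V))

/-- Write `z = (1-θ)x - θy` and `θ' = (1-s)θ + s/2`. For `k ∈ K`, the point `(1-s)(1-θ)x + (s/2)k`
lies in `(1-θ')K`; subtracting `(1-s)z` leaves `(1-s)θy + (s/2)k`, which lies in `θ'K`. The target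
height `1/2` is what splits `s` evenly between the two. -/
theorem exists_vadd_smul_subset_differenceFiber {K : Set V} (hK : Convex ℝ K) {z : V} {θ s : ℝ}
    (hs : s ∈ Icc (0 : ℝ) 1) (hz : (z, θ) ∈ jointDifference K) :
    ∃ v : V, v +ᵥ ((s / 2) • K) ⊆ differenceFiber K ((1 - s) * θ + s / 2) ((1 - s) • z) := by
  obtain ⟨hθ, x, hx, y, hy, e⟩ := hz
  dsimp only at hθ e
  have hs' : 0 ≤ s / 2 := by linarith [hs.1]
  have h1s : 0 ≤ 1 - s := sub_nonneg.2 hs.2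
  refine ⟨((1 - s) * (1 - θ)) • x, ?_⟩
  rintro _ ⟨_, ⟨k, hk, rfl⟩, rfl⟩
  obtain ⟨u, hu, eu⟩ := hK.exists_mem_add_smul_eq hx hk (mul_nonneg h1s (sub_nonneg.2 hθ.2)) hs'
  obtain ⟨v, hv, ev⟩ := hK.exists_mem_add_smul_eq hy hk (mul_nonneg h1s hθ.1) hs'
  refine ⟨⟨u, hu, ?_⟩, ⟨v, hv, ?_⟩⟩
  · have : 1 - ((1 - s) * θ + s / 2) = (1 - s) * (1 - θ) + s / 2 := by ring
    simp only [this, eu, vadd_eq_add]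
  · simp only [ev, vadd_eq_add, e]
    module

theorem slice_jointDifference_subset {K : Set V} {x₀ : V} (hx₀ : x₀ ∈ K) (θ : ℝ) :
    {z | (z, θ) ∈ jointDifference K} ⊆ (1 - 2 * θ) • x₀ +ᵥ (vectorSpan ℝ K : Set V) := by
  rintro z ⟨-, x, hx, y, hy, e⟩
  dsimp only at e
  refine ⟨(1 - θ) • (x - x₀) - θ • (y - x₀), ?_, ?_⟩
  · exact (vectorSpan ℝ K).sub_mem
      ((vectorSpan ℝ K).smul_mem _ (vsub_mem_vectorSpan ℝ hx hx₀))
      ((vectorSpan ℝ K).smul_mem _ (vsub_mem_vectorSpan ℝ hy hx₀))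
  · simp only [vadd_eq_add, e]
    module

end Sets

/-! ### Volume of slices and fibres -/

section Measures

variable {V : Type*} [NormedAddCommGroup V] [NormedSpace ℝ V] [FiniteDimensional ℝ V]
  [MeasurableSpace V] [BorelSpace V]

/-- A null convex set has empty interior, hence lies in a proper affine subspace, and each slice
lies in a translate of its direction. This settles the case where `vol K` cannot be cancelled. -/
theorem measure_slice_jointDifference_eq_zero (l : Measure V) [l.IsAddHaarMeasure] {K : Set V}
    (hK : Convex ℝ K) (h0 : l K = 0) (θ : ℝ) : l {z | (z, θ) ∈ jointDifference K} = 0 := by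
  rcases K.eq_empty_or_nonempty with rfl | ⟨x₀, hx₀⟩
  · simp [jointDifference]
  refine measure_mono_null (slice_jointDifference_subset hx₀ θ) ?_
  rw [measure_vadd]
  refine Measure.addHaar_submodule l _ fun htop => ?_
  rw [← AffineSubspace.affineSpan_eq_top_iff_vectorSpan_eq_top_of_nonempty ℝ V V ⟨x₀, hx₀⟩,
    ← hK.interior_nonempty_iff_affineSpan_eq_top] at htop
  exact (isOpen_interior.measure_pos l htop).ne' (measure_mono_null interior_subset h0)

theorem measure_differenceFiber_ge (l : Measure V) [l.IsAddHaarMeasure] {K : Set V}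
    (hK : Convex ℝ K) {z : V} {θ s : ℝ}
    (hs : s ∈ Icc (0 : ℝ) 1) (hz : (z, θ) ∈ jointDifference K) :
    ENNReal.ofReal ((s / 2) ^ Module.finrank ℝ V) * l K
      ≤ l (differenceFiber K ((1 - s) * θ + s / 2) ((1 - s) • z)) := by
  obtain ⟨v, hv⟩ := exists_vadd_smul_subset_differenceFiber hK hs hz
  rw [← Measure.addHaar_smul_of_nonneg l (by linarith [hs.1] : 0 ≤ s / 2), ← measure_vadd l v]
  exact measure_mono hv

end Measures

section SupTranslate

variable {n : ℕ}

theorem supTranslate_mono (μ : Measure (EuclideanSpace ℝ (Fin n)))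
    {K L : Set (EuclideanSpace ℝ (Fin n))} (h : K ⊆ L) : supTranslate μ K ≤ supTranslate μ L := by
  refine iSup₂_le fun y hy => iSup₂_le fun θ hθ => ?_
  refine le_trans ?_ (le_iSup₂_of_le y (h hy) (le_iSup₂_of_le θ hθ le_rfl))
  exact ENNReal.div_le_div_right (measure_mono (image_mono h)) _

theorem measure_image_le_supTranslate (μ : Measure (EuclideanSpace ℝ (Fin n)))
    {K : Set (EuclideanSpace ℝ (Fin n))} {y : EuclideanSpace ℝ (Fin n)} (hy : y ∈ K) {θ : ℝ}
    (hθ : θ ∈ Ioc (0 : ℝ) 1) :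
    μ ((fun x => (1 - θ) • y - θ • x) '' K) ≤ supTranslate μ K * ENNReal.ofReal (θ ^ n) := by
  refine (ENNReal.div_le_iff ?_ ENNReal.ofReal_ne_top).1 ?_
  · exact (ENNReal.ofReal_pos.2 (pow_pos hθ.1 n)).ne'
  · exact le_iSup₂_of_le y hy (le_iSup₂_of_le θ hθ le_rfl)

/-- Exchange the integrals: a fixed `w = (1-θ)y` lies in the fibre over `z` only if `z ∈ (1-θ)y -
θK`, a set of measure at most `θⁿ · supTranslate μ K`; the admissible `w` fill `(1-θ)K`. -/
theorem lintegral_differenceFiber_le (μ : Measure (EuclideanSpace ℝ (Fin n))) [SFinite μ]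
    (hμ : μ ≪ volume) {K : Set (EuclideanSpace ℝ (Fin n))} (hK : Convex ℝ K) {θ : ℝ}
    (hθ : θ ∈ Ioo (0 : ℝ) 1) :
    ∫⁻ z, volume (differenceFiber K θ z) ∂μ
      ≤ ENNReal.ofReal (θ ^ n * (1 - θ) ^ n) * (volume K * supTranslate μ K) := by
  have hD : NullMeasurableSet {q : EuclideanSpace ℝ (Fin n) × EuclideanSpace ℝ (Fin n) |
      q.1 ∈ differenceFiber K θ q.2} ((volume : Measure (EuclideanSpace ℝ (Fin n))).prod μ) :=
    ((convex_setOf_mem_differenceFiber hK θ).nullMeasurableSet (volume.prod volume)).mono_ac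
      (Measure.AbsolutelyContinuous.rfl.prod hμ)
  have h1 : 0 < 1 - θ := sub_pos.2 hθ.2
  calc ∫⁻ z, volume (differenceFiber K θ z) ∂μ
      = ∫⁻ w, μ {z | w ∈ differenceFiber K θ z} :=
        (measure_prod_apply_symm₀ hD).symm.trans (measure_prod_apply₀ hD)
    _ ≤ ∫⁻ w, ((1 - θ) • K).indicator (fun _ => supTranslate μ K * ENNReal.ofReal (θ ^ n)) w := by
        refine lintegral_mono fun w => ?_
        by_cases hw : w ∈ (1 - θ) • K
        · rw [indicator_of_mem hw]
          obtain ⟨y, hy, rfl⟩ := hw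
          refine le_trans (measure_mono ?_)
            (measure_image_le_supTranslate μ hy ⟨hθ.1, hθ.2.le⟩)
          rintro z ⟨-, x, hx, e⟩
          refine ⟨x, hx, ?_⟩
          simp only at e ⊢
          rw [e]
          abel
        · rw [indicator_of_notMem hw]
          refine (measure_mono_null (fun z hz => hw hz.1) (measure_empty (μ := μ))).le
    _ ≤ supTranslate μ K * ENNReal.ofReal (θ ^ n) * volume ((1 - θ) • K) :=
        lintegral_indicator_const_le _ _
    _ = _ := by
        rw [Measure.addHaar_smul_of_nonneg _ h1.le, finrank_euclideanSpace, Fintype.card_fin,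
          ENNReal.ofReal_mul (pow_nonneg hθ.1.le n)]
        ring

end SupTranslate

/-! ### The averaging weight and the beta integral -/

noncomputable section

/-- The measure `(k+1) sᵏ ds` on `(0,1)`. -/
def powerMeasure (k : ℕ) : Measure ℝ :=
  (volume.restrict (Ioo (0 : ℝ) 1)).withDensity
    (fun s => ENNReal.ofReal (((k : ℝ) + 1) * s ^ k))

end

instance (k : ℕ) : SFinite (powerMeasure k) := by
  unfold powerMeasure; infer_instance

theorem powerMeasure_absolutelyContinuous (k : ℕ) : powerMeasure k ≪ volume :=
  (withDensity_absolutelyContinuous _ _).trans Measure.absolutelyContinuous_restrict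

theorem lintegral_Ioo_ofReal_eq {a b : ℝ} (hab : a ≤ b) {g : ℝ → ℝ} (hg : Continuous g)
    (h0 : ∀ s ∈ Ioo a b, 0 ≤ g s) :
    ∫⁻ s in Ioo a b, ENNReal.ofReal (g s) = ENNReal.ofReal (∫ s in a..b, g s) := by
  rw [intervalIntegral.integral_of_le hab, integral_Ioc_eq_integral_Ioo,
    ofReal_integral_eq_lintegral_ofReal]
  · exact (hg.integrableOn_Icc (a := a) (b := b)).mono_set Ioo_subset_Icc_self
  · exact (ae_restrict_iff' measurableSet_Ioo).2 (Filter.Eventually.of_forall h0)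

/-- The weight gives `(0,σ]` mass at most `σ^(k+1)`. The mass of a set of parameters can thus
replace the supremum of `s^(k+1)` over it, and unlike the supremum it is suited to Fubini. -/
theorem powerMeasure_le {k : ℕ} {A : Set ℝ} {c : ℝ≥0∞}
    (h : ∀ s ∈ A, s ∈ Ioo (0 : ℝ) 1 → ENNReal.ofReal (s ^ (k + 1)) ≤ c) :
    powerMeasure k A ≤ c := by
  rcases eq_or_ne c ∞ with rfl | hc
  · exact le_top
  have hk : ((k : ℝ) + 1) ≠ 0 := by positivity
  set σ : ℝ := c.toReal ^ (((k + 1 : ℕ) : ℝ)⁻¹) with hσ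
  have hσ0 : 0 ≤ σ := Real.rpow_nonneg ENNReal.toReal_nonneg _
  have hσk : σ ^ (k + 1) = c.toReal :=
    Real.rpow_inv_natCast_pow ENNReal.toReal_nonneg (Nat.succ_ne_zero k)
  have hsub : A ∩ Ioo 0 1 ⊆ Ioc 0 σ := by
    rintro s ⟨hsA, hs⟩
    refine ⟨hs.1, ?_⟩
    have := (ENNReal.ofReal_le_iff_le_toReal hc).1 (h s hsA hs)
    rw [← hσk] at this
    exact le_of_pow_le_pow_left₀ (Nat.succ_ne_zero k) hσ0 this
  rw [powerMeasure, withDensity_apply', Measure.restrict_restrict' measurableSet_Ioo]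
  refine (lintegral_mono_set hsub).trans ?_
  rw [setLIntegral_congr Ioo_ae_eq_Ioc.symm, lintegral_Ioo_ofReal_eq hσ0 (by fun_prop)
    (fun s hs => mul_nonneg (by positivity) (pow_nonneg hs.1.le k)),
    intervalIntegral.integral_const_mul, integral_pow, zero_pow (Nat.succ_ne_zero k), sub_zero, hσk,
    mul_div_cancel₀ _ hk, ENNReal.ofReal_toReal hc]

/-- Integrate the derivative of `s^(k+1) (1-s)^(k+2)`, which vanishes at both ends. With `n = k+1`,
the factor `k+2` is the source of the `n+1` in the final constant. -/
theorem integral_beta_by_parts (k : ℕ) :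
    ∫ s in (0 : ℝ)..1, ((k : ℝ) + 1) * s ^ k * (1 - s) ^ (k + 2)
      = ((k : ℝ) + 2) * ∫ s in (0 : ℝ)..1, s ^ (k + 1) * (1 - s) ^ (k + 1) := by
  have hd : ∀ s ∈ uIcc (0 : ℝ) 1, HasDerivAt (fun s : ℝ => s ^ (k + 1) * (1 - s) ^ (k + 2))
      (((k : ℝ) + 1) * s ^ k * (1 - s) ^ (k + 2)
        - ((k : ℝ) + 2) * (s ^ (k + 1) * (1 - s) ^ (k + 1))) s := by
    intro s _
    have h1 := hasDerivAt_pow (k + 1) s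
    have h2 := ((hasDerivAt_id s).const_sub 1).pow (k + 2)
    refine (h1.mul h2).congr_deriv ?_
    push_cast
    simp only [id_eq, Pi.pow_apply]
    ring
  have hI := intervalIntegral.integral_eq_sub_of_hasDerivAt hd
    (Continuous.intervalIntegrable (by fun_prop) _ _)
  rw [intervalIntegral.integral_sub (Continuous.intervalIntegrable (by fun_prop) _ _)
    (Continuous.intervalIntegrable (by fun_prop) _ _), intervalIntegral.integral_const_mul] at hI
  simpa [sub_eq_zero] using hI

theorem lintegral_powerMeasure_one_sub_pow (k : ℕ) :
    ∫⁻ s, ENNReal.ofReal ((1 - s) ^ (k + 2)) ∂(powerMeasure k)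
      = ENNReal.ofReal ((k : ℝ) + 2) *
        ∫⁻ s in Ioo (0 : ℝ) 1, ENNReal.ofReal (s ^ (k + 1) * (1 - s) ^ (k + 1)) := by
  rw [powerMeasure, lintegral_withDensity_eq_lintegral_mul _ (by fun_prop) (by fun_prop),
    lintegral_Ioo_ofReal_eq zero_le_one (by fun_prop) (fun s hs => mul_nonneg
      (pow_nonneg hs.1.le _) (pow_nonneg (sub_nonneg.2 hs.2.le) _)),
    ← ENNReal.ofReal_mul (by positivity), ← integral_beta_by_parts,
    ← lintegral_Ioo_ofReal_eq zero_le_one (by fun_prop) (fun s hs => mul_nonneg (mul_nonneg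
      (by positivity) (pow_nonneg hs.1.le _)) (pow_nonneg (sub_nonneg.2 hs.2.le) _))]
  refine setLIntegral_congr_fun measurableSet_Ioo fun s hs => ?_
  exact (ENNReal.ofReal_mul (mul_nonneg (by positivity) (pow_nonneg hs.1.le _))).symm

theorem lintegral_beta_ne_zero (k : ℕ) :
    ∫⁻ s in Ioo (0 : ℝ) 1, ENNReal.ofReal (s ^ k * (1 - s) ^ k) ≠ 0 := by
  rw [lintegral_Ioo_ofReal_eq zero_le_one (by fun_prop) (fun s hs => mul_nonneg
    (pow_nonneg hs.1.le _) (pow_nonneg (sub_nonneg.2 hs.2.le) _))]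
  refine (ENNReal.ofReal_pos.2 ?_).ne'
  exact intervalIntegral.intervalIntegral_pos_of_pos_on
    (Continuous.intervalIntegrable (by fun_prop) _ _)
    (fun s hs => mul_pos (pow_pos hs.1 _) (pow_pos (sub_pos.2 hs.2) _)) zero_lt_one

theorem lintegral_beta_ne_top (k : ℕ) :
    ∫⁻ s in Ioo (0 : ℝ) 1, ENNReal.ofReal (s ^ k * (1 - s) ^ k) ≠ ∞ := by
  rw [lintegral_Ioo_ofReal_eq zero_le_one (by fun_prop) (fun s hs => mul_nonneg
    (pow_nonneg hs.1.le _) (pow_nonneg (sub_nonneg.2 hs.2.le) _))]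
  exact ENNReal.ofReal_ne_top

/-! ### Radially decreasing densities under contraction -/

section Density

variable {n : ℕ} {φ : EuclideanSpace ℝ (Fin n) → ℝ}

instance : SigmaFinite (densityMeasure φ) := by
  unfold densityMeasure; infer_instance

theorem densityMeasure_absolutelyContinuous : densityMeasure φ ≪ volume :=
  withDensity_absolutelyContinuous _ _

theorem densityMeasure_prod_absolutelyContinuous :
    (densityMeasure φ).prod (volume : Measure ℝ) ≪ volume :=
  densityMeasure_absolutelyContinuous.prod Measure.AbsolutelyContinuous.rfl

theorem pow_mul_densityMeasure_le_image (hφ : RadiallyDecreasing φ) {r : ℝ}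
    (hr : r ∈ Ioc (0 : ℝ) 1) (A : Set (EuclideanSpace ℝ (Fin n))) :
    ENNReal.ofReal (r ^ n) * densityMeasure φ A
      ≤ densityMeasure φ (AffineMap.homothety 0 r '' A) := by
  have h := pow_finrank_mul_withDensity_le_image_homothety
    (volume : Measure (EuclideanSpace ℝ (Fin n))) (ψ := fun x => ENNReal.ofReal (φ x)) 0 hr.1
    (fun x => by
      simpa [AffineMap.homothety_apply] using
        ENNReal.ofReal_le_ofReal (hφ r ⟨hr.1.le, hr.2⟩ x)) A
  rwa [finrank_euclideanSpace, Fintype.card_fin] at h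

/-- The density ignores the last coordinate, so the centre may sit at any height `τ` above the
origin. -/
theorem pow_mul_densityMeasure_prod_le_image (hφm : AEMeasurable φ volume)
    (hφ : RadiallyDecreasing φ) (τ : ℝ) {r : ℝ} (hr : r ∈ Ioc (0 : ℝ) 1)
    (A : Set (EuclideanSpace ℝ (Fin n) × ℝ)) :
    ENNReal.ofReal (r ^ (n + 1)) * (densityMeasure φ).prod volume A
      ≤ (densityMeasure φ).prod volume (AffineMap.homothety (0, τ) r '' A) := by
  have h := pow_finrank_mul_withDensity_le_image_homothety
    ((volume : Measure (EuclideanSpace ℝ (Fin n))).prod (volume : Measure ℝ))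
    (ψ := fun x => ENNReal.ofReal (φ x.1)) (0, τ) hr.1
    (fun x => by
      simpa [AffineMap.homothety_apply] using
        ENNReal.ofReal_le_ofReal (hφ r ⟨hr.1.le, hr.2⟩ x.1)) A
  rw [Module.finrank_prod, finrank_euclideanSpace, Fintype.card_fin, Module.finrank_self] at h
  have hp : (densityMeasure φ).prod (volume : Measure ℝ)
      = (volume : Measure (EuclideanSpace ℝ (Fin n) × ℝ)).withDensity
        (fun x => ENNReal.ofReal (φ x.1)) :=
    prod_withDensity_left₀ hφm.ennreal_ofReal
  rwa [hp]

end Density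

/-! ### Averaging over contractions -/

theorem slice_contractionCone {V : Type*} [AddCommGroup V] [Module ℝ V] {C : Set V} {p : V} {s : ℝ}
    (hs : s ∈ Ioo (0 : ℝ) 1) :
    {x | (x, s) ∈ contractionCone C p} = AffineMap.homothety p (1 - s) '' C := by
  ext x
  constructor
  · rintro ⟨-, c, hc, e⟩
    refine ⟨c, hc, ?_⟩
    dsimp only at e
    rw [e, AffineMap.homothety_apply, vsub_eq_sub, vadd_eq_add]
    module
  · rintro ⟨c, hc, rfl⟩
    refine ⟨hs, c, hc, ?_⟩
    rw [AffineMap.homothety_apply, vsub_eq_sub, vadd_eq_add]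
    module

section ContractionCone

variable {V : Type*} [NormedAddCommGroup V] [NormedSpace ℝ V] [FiniteDimensional ℝ V]
  [MeasurableSpace V] [BorelSpace V]

theorem nullMeasurableSet_contractionCone [SecondCountableTopology V] (l : Measure V)
    [l.IsAddHaarMeasure] {C : Set V} (hC : Convex ℝ C)
    (p : V) {ν : Measure V} [SFinite ν] (hν : ν ≪ l) (k : ℕ) :
    NullMeasurableSet (contractionCone C p) (ν.prod (powerMeasure k)) :=
  ((convex_contractionCone hC p).nullMeasurableSet (l.prod volume)).mono_ac
    (hν.prod (powerMeasure_absolutelyContinuous k))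

/-- Fubini on the cone: its slice at `s` is `C` contracted by `1-s`, whose measure is bounded below
by `h`. -/
theorem measure_mul_le_lintegral_powerMeasure [SecondCountableTopology V] (l : Measure V)
    [l.IsAddHaarMeasure] {C : Set V}
    (hC : Convex ℝ C) (p : V) {ν : Measure V} [SFinite ν] (hν : ν ≪ l) (k : ℕ) {d : ℕ}
    (h : ∀ r ∈ Ioc (0 : ℝ) 1, ENNReal.ofReal (r ^ d) * ν C ≤ ν (AffineMap.homothety p r '' C)) :
    (∫⁻ s, ENNReal.ofReal ((1 - s) ^ d) ∂(powerMeasure k)) * ν C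
      ≤ ∫⁻ x, powerMeasure k {s | (x, s) ∈ contractionCone C p} ∂ν := by
  have hQ := nullMeasurableSet_contractionCone l hC p hν k
  rw [← measure_prod_apply₀ hQ, measure_prod_apply_symm₀ hQ, ← lintegral_mul_const _ (by fun_prop)]
  refine lintegral_mono_ae ?_
  have hae : ∀ᵐ s ∂(powerMeasure k), s ∈ Ioo (0 : ℝ) 1 :=
    (withDensity_absolutelyContinuous _ _).ae_le (ae_restrict_mem measurableSet_Ioo)
  filter_upwards [hae] with s hs
  rw [slice_contractionCone hs]
  exact h (1 - s) ⟨sub_pos.2 hs.2, by linarith [hs.1]⟩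

end ContractionCone

/-! ### Rogers–Shephard inequalities for convex sets -/

variable {n : ℕ}

/-- Every `s` for which `(z, θ)` is a contracted point forces the fibre to have volume at least
`(s/2)^(k+1) vol K`; `powerMeasure_le` turns this into a bound on the mass of all such `s`. -/
theorem mul_powerMeasure_contractionCone_le {k : ℕ}
    {K : Set (EuclideanSpace ℝ (Fin (k + 1)))} (hK : Convex ℝ K) (h0 : volume K ≠ 0)
    (htop : volume K ≠ ∞) (z : EuclideanSpace ℝ (Fin (k + 1))) (θ : ℝ) :
    ENNReal.ofReal ((1 / 2) ^ (k + 1)) * volume K *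
        powerMeasure k {s | ((z, θ), s) ∈ contractionCone (jointDifference K) (0, 1 / 2)}
      ≤ volume (differenceFiber K θ z) := by
  have hc0 : ENNReal.ofReal ((1 / 2) ^ (k + 1)) * volume K ≠ 0 :=
    mul_ne_zero (ENNReal.ofReal_pos.2 (by positivity)).ne' h0
  have hct : ENNReal.ofReal ((1 / 2) ^ (k + 1)) * volume K ≠ ∞ :=
    ENNReal.mul_ne_top ENNReal.ofReal_ne_top htop
  rw [mul_comm, ← ENNReal.le_div_iff_mul_le (Or.inl hc0) (Or.inl hct)]
  refine powerMeasure_le fun s hs _ => ?_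
  obtain ⟨hs, ⟨z₀, θ₀⟩, hc, e⟩ := hs
  rw [ENNReal.le_div_iff_mul_le (Or.inl hc0) (Or.inl hct), ← mul_assoc,
    ← ENNReal.ofReal_mul (pow_nonneg hs.1.le _), ← mul_pow]
  have h := measure_differenceFiber_ge volume hK ⟨hs.1.le, hs.2.le⟩ hc
  simp only [Prod.smul_mk, Prod.mk_add_mk, smul_zero, add_zero, smul_eq_mul, Prod.mk.injEq] at e
  rw [finrank_euclideanSpace, Fintype.card_fin] at h
  rw [e.1, e.2, mul_one_div]
  exact h

theorem mem_Ioo_of_mem_contractionCone_jointDifference {K : Set (EuclideanSpace ℝ (Fin n))}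
    {z : EuclideanSpace ℝ (Fin n)} {θ s : ℝ}
    (h : ((z, θ), s) ∈ contractionCone (jointDifference K) (0, 1 / 2)) : θ ∈ Ioo (0 : ℝ) 1 := by
  obtain ⟨hs, ⟨z₀, θ₀⟩, hc, e⟩ := h
  have hθ := hc.1
  simp only [Prod.smul_mk, Prod.mk_add_mk, smul_zero, add_zero, smul_eq_mul, Prod.mk.injEq]
    at e hθ hs
  rw [e.2]
  constructor
  · nlinarith [mul_nonneg (sub_nonneg.2 hs.2.le) hθ.1, hs.1]
  · nlinarith [mul_nonneg (sub_nonneg.2 hs.2.le) (sub_nonneg.2 hθ.2), hs.1]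

theorem jointDifference_subset (K : Set (EuclideanSpace ℝ (Fin n))) :
    jointDifference K ⊆ univ ×ˢ Icc (0 : ℝ) 1 := fun _ hp => ⟨mem_univ _, hp.1⟩

theorem measure_jointDifference_le_of_dim_zero (μ : Measure (EuclideanSpace ℝ (Fin 0))) [SFinite μ]
    (K : Set (EuclideanSpace ℝ (Fin 0))) :
    μ.prod volume (jointDifference K) ≤ supTranslate μ K := by
  rcases K.eq_empty_or_nonempty with rfl | ⟨y, hy⟩
  · simp [jointDifference]
  refine (measure_mono (jointDifference_subset K)).trans ?_
  rw [Measure.prod_prod, Real.volume_Icc, sub_zero, ENNReal.ofReal_one, mul_one]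
  have h := measure_image_le_supTranslate μ hy (θ := 1) ⟨zero_lt_one, le_rfl⟩
  rw [pow_zero, ENNReal.ofReal_one, mul_one] at h
  refine (measure_mono ?_).trans h
  exact fun x _ => ⟨y, hy, Subsingleton.elim _ _⟩

theorem measure_jointDifference_eq_zero {μ : Measure (EuclideanSpace ℝ (Fin n))} [SFinite μ]
    (hμ : μ ≪ volume) {K : Set (EuclideanSpace ℝ (Fin n))} (hK : Convex ℝ K)
    (h0 : volume K = 0) : μ.prod volume (jointDifference K) = 0 := by
  have hC : NullMeasurableSet (jointDifference K) (μ.prod volume) :=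
    ((convex_jointDifference hK).nullMeasurableSet (volume.prod volume)).mono_ac
      (hμ.prod Measure.AbsolutelyContinuous.rfl)
  rw [measure_prod_apply_symm₀ hC]
  simp only [fun θ => hμ (measure_slice_jointDifference_eq_zero volume hK h0 θ), lintegral_zero]

/-- The Rogers–Shephard inequality for the joint difference set and a measure with radially
decreasing density. -/
theorem measure_jointDifference_le {φ : EuclideanSpace ℝ (Fin n) → ℝ}
    (hφm : AEMeasurable φ volume) (hφ : RadiallyDecreasing φ)
    {K : Set (EuclideanSpace ℝ (Fin n))} (hK : Convex ℝ K) (htop : volume K ≠ ∞) :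
    (densityMeasure φ).prod volume (jointDifference K)
      ≤ ENNReal.ofReal ((2 : ℝ) ^ n / ((n : ℝ) + 1)) * supTranslate (densityMeasure φ) K := by
  -- The weight `n sⁿ⁻¹` needs `n ≥ 1`, so dimension zero is treated apart.
  rcases n with _ | k
  · simpa using measure_jointDifference_le_of_dim_zero (densityMeasure φ) K
  rcases eq_or_ne (volume K) 0 with h0 | h0
  · rw [measure_jointDifference_eq_zero densityMeasure_absolutelyContinuous hK h0]
    exact zero_le
  set μ := densityMeasure φ
  have hμ : μ.prod (volume : Measure ℝ) ≪ volume.prod volume :=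
    densityMeasure_prod_absolutelyContinuous
  have hC := convex_jointDifference hK
  set C := jointDifference K
  set S := supTranslate μ K
  set I := ∫⁻ s in Ioo (0 : ℝ) 1, ENNReal.ofReal (s ^ (k + 1) * (1 - s) ^ (k + 1)) with hI
  set c := ENNReal.ofReal ((1 / 2) ^ (k + 1)) * volume K with hc
  set G : EuclideanSpace ℝ (Fin (k + 1)) × ℝ → ℝ≥0∞ :=
    fun x => powerMeasure k {s | (x, s) ∈ contractionCone C (0, 1 / 2)} with hG
  have hGm : AEMeasurable G (μ.prod volume) := aemeasurable_measure_prodMk₀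
    (nullMeasurableSet_contractionCone (volume.prod volume) hC _ hμ k)
  have hlow := measure_mul_le_lintegral_powerMeasure (volume.prod volume) hC (0, 1 / 2) hμ k
    (fun r hr => pow_mul_densityMeasure_prod_le_image hφm hφ (1 / 2) hr C)
  rw [lintegral_powerMeasure_one_sub_pow] at hlow
  -- Contracted points have `θ` strictly inside `(0,1)`, so `G` vanishes for all other `θ` and the
  -- Fubini bound on fibres applies wherever it is needed.
  have hup : c * ∫⁻ x, G x ∂(μ.prod volume) ≤ I * (volume K * S) := by
    have hle : ∀ θ, c * ∫⁻ z, G (z, θ) ∂μ ≤ (Ioo (0 : ℝ) 1).indicator (fun θ =>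
        ENNReal.ofReal (θ ^ (k + 1) * (1 - θ) ^ (k + 1)) * (volume K * S)) θ := by
      intro θ
      by_cases hθ : θ ∈ Ioo (0 : ℝ) 1
      · rw [indicator_of_mem hθ]
        refine le_trans ?_ (lintegral_differenceFiber_le μ densityMeasure_absolutelyContinuous hK hθ)
        refine (lintegral_const_mul_le _ _).trans (lintegral_mono fun z => ?_)
        exact mul_powerMeasure_contractionCone_le hK h0 htop z θ
      · rw [indicator_of_notMem hθ]
        have : ∀ z, G (z, θ) = 0 := fun z => measure_mono_null
          (fun s hs => hθ (mem_Ioo_of_mem_contractionCone_jointDifference hs)) (measure_empty)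
        simp [this]
    rw [lintegral_prod_symm _ hGm, ← lintegral_const_mul' _ _
      (ENNReal.mul_ne_top ENNReal.ofReal_ne_top htop)]
    refine (lintegral_mono hle).trans ?_
    rw [lintegral_indicator measurableSet_Ioo, lintegral_mul_const _ (by fun_prop)]
  have hI0 : I ≠ 0 := lintegral_beta_ne_zero (k + 1)
  have hIt : I ≠ ∞ := lintegral_beta_ne_top (k + 1)
  have hmain : (I * volume K) * (ENNReal.ofReal ((1 / 2) ^ (k + 1) * ((k : ℝ) + 2)) *
      μ.prod volume C) ≤ (I * volume K) * S := by
    calc _ = c * (ENNReal.ofReal ((k : ℝ) + 2) * I * μ.prod volume C) := by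
          rw [ENNReal.ofReal_mul (by positivity), hc]; ring
      _ ≤ c * ∫⁻ x, G x ∂(μ.prod volume) := mul_le_mul_right hlow _
      _ ≤ I * (volume K * S) := hup
      _ = _ := by ring
  rw [ENNReal.mul_le_mul_iff_right (mul_ne_zero hI0 h0) (ENNReal.mul_ne_top hIt htop)] at hmain
  calc μ.prod volume C
      = ENNReal.ofReal ((2 : ℝ) ^ (k + 1) / (((k + 1 : ℕ) : ℝ) + 1)) *
        (ENNReal.ofReal ((1 / 2) ^ (k + 1) * ((k : ℝ) + 2)) * μ.prod volume C) := by
        rw [← mul_assoc, ← ENNReal.ofReal_mul (by positivity)]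
        have : (2 : ℝ) ^ (k + 1) / (((k + 1 : ℕ) : ℝ) + 1) * ((1 / 2) ^ (k + 1) * ((k : ℝ) + 2))
            = 1 := by
          push_cast
          rw [one_div, inv_pow]
          have : (k : ℝ) + 1 + 1 ≠ 0 := by positivity
          field_simp
          ring
        rw [this, ENNReal.ofReal_one, one_mul]
    _ ≤ _ := mul_le_mul_right hmain _

/-- A convex hull `conv (K ∪ -K)` is controlled by the joint difference set when `0` lies in the
closure of `K`. -/
theorem measure_fst_image_jointDifference_le {φ : EuclideanSpace ℝ (Fin n) → ℝ}
    (hφ : RadiallyDecreasing φ) {K : Set (EuclideanSpace ℝ (Fin n))} (hK : Convex ℝ K)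
    (h0 : 0 ∈ closure K) :
    densityMeasure φ (Prod.fst '' jointDifference K)
      ≤ ENNReal.ofReal ((n : ℝ) + 1) * (densityMeasure φ).prod volume (jointDifference K) := by
  set μ := densityMeasure φ
  have hC := convex_jointDifference hK
  -- Taking `x = y` puts `((1-2τ)x, τ)` in the joint difference set; let `x` tend to `0` within `K`.
  have hzero : ∀ τ ∈ Icc (0 : ℝ) 1,
      ((0 : EuclideanSpace ℝ (Fin n)), τ) ∈ closure (jointDifference K) := by
    intro τ hτ
    have hcont : Continuous fun x : EuclideanSpace ℝ (Fin n) => ((1 - 2 * τ) • x, τ) := by fun_prop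
    have hm : MapsTo (fun x : EuclideanSpace ℝ (Fin n) => ((1 - 2 * τ) • x, τ)) K
        (jointDifference K) := fun x hx => ⟨hτ, x, hx, x, hx, by dsimp only; module⟩
    simpa using hm.closure hcont h0
  have hH : Convex ℝ (Prod.fst '' jointDifference K) :=
    hC.linear_image (LinearMap.fst ℝ (EuclideanSpace ℝ (Fin n)) ℝ)
  -- Exponent `0` gives the uniform weight, because the fibre lengths below grow linearly in `s`.
  have hlow := measure_mul_le_lintegral_powerMeasure volume hH 0
    (densityMeasure_absolutelyContinuous (φ := φ)) 0
    (fun r hr => pow_mul_densityMeasure_le_image hφ hr _)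
  have hint : ∫⁻ s, ENNReal.ofReal ((1 - s) ^ n) ∂(powerMeasure 0)
      = ENNReal.ofReal (1 / ((n : ℝ) + 1)) := by
    have : powerMeasure 0 = volume.restrict (Ioo (0 : ℝ) 1) := by simp [powerMeasure]
    rw [this, lintegral_Ioo_ofReal_eq zero_le_one (by fun_prop)
      (fun s hs => pow_nonneg (sub_nonneg.2 hs.2.le) _),
      intervalIntegral.integral_comp_sub_left (fun x => x ^ n)]
    simp
  -- The segment over `0` lies only in the closure; this costs nothing, as the frontier of a convex
  -- set is null.
  have hcl : (μ.prod volume) (closure (jointDifference K)) = μ.prod volume (jointDifference K) := by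
    refine measure_congr (Filter.EventuallyEq.symm ?_)
    have hfr : μ.prod volume (frontier (jointDifference K)) = 0 :=
      densityMeasure_prod_absolutelyContinuous (hC.addHaar_frontier (volume.prod volume))
    refine (LE.le.eventuallyLE subset_closure).antisymm (ae_le_set.2 ?_)
    refine measure_mono_null ?_ hfr
    exact fun x hx => ⟨hx.1, fun h => hx.2 (interior_subset h)⟩
  have hup : ∫⁻ z, powerMeasure 0 {s | (z, s) ∈ contractionCone (Prod.fst '' jointDifference K) 0}
      ∂μ ≤ μ.prod volume (jointDifference K) := by
    rw [← hcl, Measure.prod_apply isClosed_closure.measurableSet]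
    refine lintegral_mono fun z => powerMeasure_le fun s hs _ => ?_
    obtain ⟨hs, _, ⟨⟨z₀, θ₀⟩, hc, rfl⟩, e⟩ := hs
    dsimp only at hs e
    rw [smul_zero, add_zero] at e
    rw [zero_add, pow_one]
    -- These are the heights of `(1-s)(z₀, θ₀) + s(0, τ)` as `τ` runs through `[0,1]`.
    have hsub : Icc ((1 - s) * θ₀) ((1 - s) * θ₀ + s)
        ⊆ Prod.mk z ⁻¹' closure (jointDifference K) := by
      intro t ht
      have hτ : (t - (1 - s) * θ₀) / s ∈ Icc (0 : ℝ) 1 :=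
        ⟨div_nonneg (by linarith [ht.1]) hs.1.le, (div_le_one hs.1).2 (by linarith [ht.2])⟩
      have h := hC.closure (subset_closure hc) (hzero _ hτ) (sub_nonneg.2 hs.2.le) hs.1.le
        (sub_add_cancel 1 s)
      simp only [Prod.smul_mk, Prod.mk_add_mk, smul_zero, add_zero, smul_eq_mul] at h
      rw [mul_div_cancel₀ _ hs.1.ne', add_sub_cancel, ← e] at h
      exact h
    calc ENNReal.ofReal s = volume (Icc ((1 - s) * θ₀) ((1 - s) * θ₀ + s)) := by
          rw [Real.volume_Icc, add_sub_cancel_left]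
      _ ≤ _ := measure_mono hsub
  rw [hint] at hlow
  calc μ (Prod.fst '' jointDifference K)
      = ENNReal.ofReal ((n : ℝ) + 1) *
        (ENNReal.ofReal (1 / ((n : ℝ) + 1)) * μ (Prod.fst '' jointDifference K)) := by
        rw [← mul_assoc, ← ENNReal.ofReal_mul (by positivity), mul_one_div_cancel (by positivity),
          ENNReal.ofReal_one, one_mul]
    _ ≤ _ := mul_le_mul_right (hlow.trans hup) _

theorem measure_fst_image_jointDifference_le_supTranslate {φ : EuclideanSpace ℝ (Fin n) → ℝ}
    (hφm : AEMeasurable φ volume) (hφ : RadiallyDecreasing φ)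
    {K : Set (EuclideanSpace ℝ (Fin n))} (hK : Convex ℝ K) (htop : volume K ≠ ∞)
    (h0 : 0 ∈ closure K) :
    densityMeasure φ (Prod.fst '' jointDifference K)
      ≤ ENNReal.ofReal ((2 : ℝ) ^ n) * supTranslate (densityMeasure φ) K := by
  refine (measure_fst_image_jointDifference_le hφ hK h0).trans ?_
  refine (mul_le_mul_right (measure_jointDifference_le hφm hφ hK htop) _).trans_eq ?_
  rw [← mul_assoc, ← ENNReal.ofReal_mul (by positivity), mul_div_cancel₀ _ (by positivity)]

/-! ### Level sets of the difference functions and integration over heights -/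

section LevelSets

variable {n : ℕ} {f : EuclideanSpace ℝ (Fin n) → ℝ}

theorem lt_ofReal_min_iff {t : ℝ≥0∞} {a b : ℝ} :
    t < ENNReal.ofReal (min a b) ↔ t < ENNReal.ofReal a ∧ t < ENNReal.ofReal b := by
  rw [ENNReal.ofReal_mono.map_min, lt_min_iff]

/-- A supremum exceeds `t` exactly when some competitor does, so strict level sets give an equality
without any attainment. The indicator supplies the constraint `θ ∈ [0,1]`. -/
theorem setOf_lt_thetaDifference (f : EuclideanSpace ℝ (Fin n) → ℝ) (t : ℝ≥0∞) :
    {p : EuclideanSpace ℝ (Fin n) × ℝ |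
        t < (Icc (0 : ℝ) 1).indicator (fun θ => thetaDifference θ f p.1) p.2}
      = jointDifference {x | t < ENNReal.ofReal (f x)} := by
  ext ⟨z, θ⟩
  by_cases hθ : θ ∈ Icc (0 : ℝ) 1
  · have : (Icc (0 : ℝ) 1).indicator (fun θ => thetaDifference θ f z) θ = thetaDifference θ f z :=
      indicator_of_mem hθ _
    rw [mem_ofPred_eq, this]
    simp only [jointDifference, mem_ofPred_eq, thetaDifference, lt_iSup_iff, lt_ofReal_min_iff]
    constructor
    · rintro ⟨x, y, e, hx, hy⟩
      exact ⟨hθ, x, hx, y, hy, e⟩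
    · rintro ⟨-, x, hx, y, hy, e⟩
      exact ⟨x, y, e, hx, hy⟩
  · have : (Icc (0 : ℝ) 1).indicator (fun θ => thetaDifference θ f z) θ = 0 :=
      indicator_of_notMem hθ _
    simp only [jointDifference, mem_ofPred_eq, this, hθ, not_lt_zero, false_and]

theorem setOf_lt_hullDifference (f : EuclideanSpace ℝ (Fin n) → ℝ) (t : ℝ≥0∞) :
    {z | t < hullDifference f z}
      = Prod.fst '' jointDifference {x | t < ENNReal.ofReal (f x)} := by
  ext z
  simp only [mem_ofPred_eq, hullDifference, lt_iSup_iff, lt_ofReal_min_iff]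
  constructor
  · rintro ⟨θ, hθ, x, y, e, hx, hy⟩
    exact ⟨(z, θ), ⟨hθ, x, hx, y, hy, e⟩, rfl⟩
  · rintro ⟨⟨z, θ⟩, ⟨hθ, x, hx, y, hy, e⟩, rfl⟩
    exact ⟨θ, hθ, x, y, e, hx, hy⟩

theorem convex_setOf_lt_ofReal (hf : QuasiconcaveOn ℝ univ f) (t : ℝ≥0∞) :
    Convex ℝ {x | t < ENNReal.ofReal (f x)} := by
  rcases eq_or_ne t ∞ with rfl | ht
  · simp [convex_empty]
  · have h := hf.convex_gt t.toReal
    simpa only [mem_univ, true_and, ENNReal.lt_ofReal_iff_toReal_lt ht] using h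

theorem setOf_ofReal_lt_ofReal {t : ℝ} (ht : 0 < t) :
    {x | ENNReal.ofReal t < ENNReal.ofReal (f x)} = superlevelGT f t := by
  ext x
  exact ENNReal.ofReal_lt_ofReal_iff_of_nonneg ht.le

theorem volume_superlevelGT_ne_top (hf : Integrable f volume) {t : ℝ} (ht : 0 < t) :
    volume (superlevelGT f t) ≠ ∞ :=
  (hf.measure_gt_lt_top ht).ne

theorem superlevelGT_subset_superlevelGE (f : EuclideanSpace ℝ (Fin n) → ℝ) (t : ℝ) :
    superlevelGT f t ⊆ superlevelGE f t := 
  fun x (hx : t < f x) => hx.le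

theorem lintegral_thetaDifference_le {φ : EuclideanSpace ℝ (Fin n) → ℝ}
    (hφm : AEMeasurable φ volume) (hφ : RadiallyDecreasing φ)
    (hf : QuasiconcaveOn ℝ univ f) (hfi : Integrable f volume) :
    ∫⁻ θ in Icc (0 : ℝ) 1, ∫⁻ x, thetaDifference θ f x ∂(densityMeasure φ)
      ≤ ENNReal.ofReal ((2 : ℝ) ^ n / ((n : ℝ) + 1)) *
        ∫⁻ t in Ioi (0 : ℝ), supTranslate (densityMeasure φ) (superlevelGE f t) := by
  set F : EuclideanSpace ℝ (Fin n) × ℝ → ℝ≥0∞ :=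
    fun p => (Icc (0 : ℝ) 1).indicator (fun θ => thetaDifference θ f p.1) p.2 with hF
  have hFm : AEMeasurable F ((densityMeasure φ).prod volume) := by
    refine aemeasurable_of_nullMeasurableSet_lt fun t => ?_
    rw [setOf_lt_thetaDifference]
    exact ((convex_jointDifference (convex_setOf_lt_ofReal hf t)).nullMeasurableSet
      (volume.prod volume)).mono_ac densityMeasure_prod_absolutelyContinuous
  have hFint : ∫⁻ θ in Icc (0 : ℝ) 1, ∫⁻ x, thetaDifference θ f x ∂(densityMeasure φ)
      = ∫⁻ p, F p ∂((densityMeasure φ).prod volume) := by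
    rw [lintegral_prod_symm _ hFm, ← lintegral_indicator measurableSet_Icc]
    refine lintegral_congr fun θ => ?_
    by_cases hθ : θ ∈ Icc (0 : ℝ) 1 <;> simp only [hF, indicator, hθ, if_true, if_false,
      lintegral_zero]
  rw [hFint, lintegral_eq_lintegral_measure_ofReal_lt hFm,
    ← lintegral_const_mul' _ _ ENNReal.ofReal_ne_top]
  refine setLIntegral_mono' measurableSet_Ioi fun t ht => ?_
  have hK := convex_setOf_lt_ofReal hf (ENNReal.ofReal t)
  rw [setOf_lt_thetaDifference]
  rw [setOf_ofReal_lt_ofReal ht] at hK ⊢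
  exact (measure_jointDifference_le hφm hφ hK (volume_superlevelGT_ne_top hfi ht)).trans
    (mul_le_mul_right (supTranslate_mono _ (superlevelGT_subset_superlevelGE f t)) _)

theorem lintegral_hullDifference_le {φ : EuclideanSpace ℝ (Fin n) → ℝ}
    (hφm : AEMeasurable φ volume) (hφ : RadiallyDecreasing φ)
    (hf : QuasiconcaveOn ℝ univ f) (hfi : Integrable f volume)
    (h0 : ∀ t : ℝ, (superlevelGT f t).Nonempty → 0 ∈ closure (superlevelGT f t)) :
    ∫⁻ x, hullDifference f x ∂(densityMeasure φ)
      ≤ ENNReal.ofReal ((2 : ℝ) ^ n) *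
        ∫⁻ t in Ioi (0 : ℝ), supTranslate (densityMeasure φ) (superlevelGE f t) := by
  have hFm : AEMeasurable (hullDifference f) (densityMeasure φ) := by
    refine aemeasurable_of_nullMeasurableSet_lt fun t => ?_
    rw [setOf_lt_hullDifference]
    exact (((convex_jointDifference (convex_setOf_lt_ofReal hf t)).linear_image
      (LinearMap.fst ℝ (EuclideanSpace ℝ (Fin n)) ℝ)).nullMeasurableSet volume).mono_ac
      densityMeasure_absolutelyContinuous
  rw [lintegral_eq_lintegral_measure_ofReal_lt hFm,
    ← lintegral_const_mul' _ _ ENNReal.ofReal_ne_top]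
  refine setLIntegral_mono' measurableSet_Ioi fun t ht => ?_
  have hK := convex_setOf_lt_ofReal hf (ENNReal.ofReal t)
  rw [setOf_lt_hullDifference]
  rw [setOf_ofReal_lt_ofReal ht] at hK ⊢
  rcases (superlevelGT f t).eq_empty_or_nonempty with he | hne
  · simp [he, jointDifference]
  · exact (measure_fst_image_jointDifference_le_supTranslate hφm hφ hK
      (volume_superlevelGT_ne_top hfi ht) (h0 t hne)).trans
      (mul_le_mul_right (supTranslate_mono _ (superlevelGT_subset_superlevelGE f t)) _)

/-- By translation invariance and scaling, each quotient has numerator `θⁿ vol K`. -/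
theorem supTranslate_volume_le (K : Set (EuclideanSpace ℝ (Fin n))) :
    supTranslate volume K ≤ volume K := by
  refine iSup₂_le fun y _ => iSup₂_le fun θ hθ => ENNReal.div_le_of_le_mul ?_
  have : (fun x => (1 - θ) • y - θ • x) '' K = ((1 - θ) • y) +ᵥ ((-θ) • K) := by
    simp only [← image_vadd, ← image_smul, image_image, vadd_eq_add, neg_smul, sub_eq_add_neg]
  rw [this, measure_vadd, Measure.addHaar_smul, finrank_euclideanSpace, Fintype.card_fin, abs_pow,
    abs_neg, abs_of_pos hθ.1, mul_comm]

theorem lintegral_supTranslate_volume_le (hf0 : ∀ x, 0 ≤ f x) (hfi : Integrable f volume) :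
    ∫⁻ t in Ioi (0 : ℝ), supTranslate volume (superlevelGE f t)
      ≤ ENNReal.ofReal (∫ x, f x) := by
  have h0 : 0 ≤ᵐ[volume] f := Filter.Eventually.of_forall hf0
  rw [ofReal_integral_eq_lintegral_ofReal hfi h0,
    lintegral_eq_lintegral_meas_le volume h0 hfi.aemeasurable]
  exact lintegral_mono fun t => supTranslate_volume_le _

theorem densityMeasure_one :
    densityMeasure (fun _ : EuclideanSpace ℝ (Fin n) => (1 : ℝ)) = volume := by
  simp only [densityMeasure, ENNReal.ofReal_one]
  exact withDensity_one

end LevelSets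

theorem theoremt (n : ℕ) (f : EuclideanSpace ℝ (Fin n) → ℝ)
    (hf_nonneg : ∀ x, 0 ≤ f x)
    (hf_quasi : QuasiconcaveOn ℝ (Set.univ : Set (EuclideanSpace ℝ (Fin n))) f)
    (hf_int : Integrable f volume) :
    -- measures with radially decreasing density
    (∀ φ : EuclideanSpace ℝ (Fin n) → ℝ, (∀ x, 0 ≤ φ x) → AEMeasurable φ volume →
      RadiallyDecreasing φ →
        (∫⁻ θ in Set.Icc (0 : ℝ) 1, ∫⁻ x, thetaDifference θ f x ∂(densityMeasure φ))
            ≤ ENNReal.ofReal ((2 : ℝ) ^ n / ((n : ℝ) + 1)) *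
              ∫⁻ t in Set.Ioi (0 : ℝ), supTranslate (densityMeasure φ) (superlevelGE f t)
        ∧ ((∀ t : ℝ, (superlevelGT f t).Nonempty → 0 ∈ closure (superlevelGT f t)) →
            (∫⁻ x, hullDifference f x ∂(densityMeasure φ))
              ≤ ENNReal.ofReal ((2 : ℝ) ^ n) *
                ∫⁻ t in Set.Ioi (0 : ℝ), supTranslate (densityMeasure φ) (superlevelGE f t)))
    -- Lebesgue measure
    ∧ (∫⁻ θ in Set.Icc (0 : ℝ) 1, ∫⁻ x, thetaDifference θ f x ∂volume)
        ≤ ENNReal.ofReal ((2 : ℝ) ^ n / ((n : ℝ) + 1) * ∫ x, f x ∂volume)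
    ∧ ((∀ t : ℝ, (superlevelGT f t).Nonempty → 0 ∈ closure (superlevelGT f t)) →
        (∫⁻ x, hullDifference f x ∂volume)
          ≤ ENNReal.ofReal ((2 : ℝ) ^ n * ∫ x, f x ∂volume)) := by

  have h1 : RadiallyDecreasing (fun _ : EuclideanSpace ℝ (Fin n) => (1 : ℝ)) :=
    fun _ _ _ => le_rfl
  refine ⟨fun φ _ hφm hφ => ⟨lintegral_thetaDifference_le hφm hφ hf_quasi hf_int,
    lintegral_hullDifference_le hφm hφ hf_quasi hf_int⟩, ?_, fun h0 => ?_⟩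
  · have h := lintegral_thetaDifference_le aemeasurable_const h1 hf_quasi hf_int
    rw [densityMeasure_one] at h
    rw [ENNReal.ofReal_mul (by positivity)]
    exact h.trans (mul_le_mul_right (lintegral_supTranslate_volume_le hf_nonneg hf_int) _)
  · have h := lintegral_hullDifference_le aemeasurable_const h1 hf_quasi hf_int h0
    rw [densityMeasure_one] at h
    rw [ENNReal.ofReal_mul (by positivity)]
    exact h.trans (mul_le_mul_right (lintegral_supTranslate_volume_le hf_nonneg hf_int) _)
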